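/- Let $\Bbbk$ be an algebraically closed field of characteristic zero. For $n \ge 2$ let $\mathcal E_n$ be the Fomin-Kirillov algebra, that is, the associative $\Bbbk$-algebra generated by $x_{i,j}$, $1 \le i < j \le n$, subject to the relations $$x_{i,j}^2 = 0 \quad (i<j), \qquad x_{i,j}x_{j,l} - x_{j,l}x_{i,l} - x_{i,l}x_{i,j} = 0 \quad (i<j<l),$$ $$x_{j,l}x_{i,j} - x_{i,l}x_{j,l} - x_{i,j}x_{i,l} = 0 \quad (i<j<l), \qquad x_{i,j}x_{l,m} - x_{l,m}x_{i,j} = 0 \quad (\{i,j\}\cap\{l,m\}=\emptyset,\ i<j,\ l<m).$$ Let $\Bbbk$ also denote the trivial $\mathcal E_n$-module, on which every $x_{i,j}$ acts as $0$, and let $\mathrm{Ext}^*_{\mathcal E_n}(\Bbbk,\Bbbk) = \bigoplus_{i \ge 0} \mathrm{Ext}^i_{\mathcal E_n}(\Bbbk,\Bbbk)$ be the Ext algebra with the Yoneda product. For a $\Bbbk$-algebra $A$ put $$\mathrm{GKdim}(A) = \sup_V \limsup_{m\to\infty} \frac{\log \dim_\Bbbk (V^0 + V^1 + \dots + V^m)}{\log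 m},$$ the supremum being over all finite-dimensional subspaces $V \subseteq A$; for an $\mathbb N$-graded algebra $A = \bigoplus_i A_i$ put $$\mathrm{GKdim}_{\mathrm{gr}}(A) = \limsup_{m\to\infty} \frac{\log \sum_{i=0}^m \dim_\Bbbk A_i}{\log m}$$ (with value $\infty$ if some $A_i$ is infinite-dimensional). Then: 1. If $n \ge 2$, then $\mathrm{GKdim}\big(\mathrm{Ext}^*_{\mathcal E_n}(\Bbbk,\Bbbk)\big) \ge \lfloor n/2 \rfloor$ and $\mathrm{GKdim}_{\mathrm{gr}}\big(\mathrm{Ext}^*_{\mathcal E_n}(\Bbbk,\Bbbk)\big) \ge \lfloor n/2 \rfloor$, the latter for the grading by cohomological degree. 2. If $n \ge 3$, then $\mathrm{Ext}^*_{\mathcal E_n}(\Bbbk,\Bbbk)$ is not a domain: there are nonzero $a, b$ in it with $ab = 0$. -/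

import Mathlib

open CategoryTheory
open scoped DirectSum

universe u v w

/-! ### The Ext algebra of an object of a linear abelian category -/

namespace ExtAlg

variable {C : Type u} [Category.{v} C] [Abelian C] [HasExt.{w} C]

lemma mk_comp_eq {X Y Z : C} {i j l m : ℕ} (a : Abelian.Ext X Y i) (b : Abelian.Ext Y Z j)
    (h : i + j = l) (h' : i + j = m) :
    (⟨l, a.comp b h⟩ : Σ r : ℕ, Abelian.Ext X Z r) = ⟨m, a.comp b h'⟩ := by
  subst h; subst h'; rfl

/-- The graded multiplication: the Yoneda product `Ext X X i × Ext X X j → Ext X X (i + j)`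
(composition written in diagrammatic order). -/
noncomputable instance instGMul (X : C) : GradedMonoid.GMul (fun i : ℕ => Abelian.Ext X X i) where
  mul a b := a.comp b rfl

/-- The unit is the identity of `X`, an element of `Ext X X 0 = Hom X X`. -/
noncomputable instance instGOne (X : C) : GradedMonoid.GOne (fun i : ℕ => Abelian.Ext X X i) where
  one := Abelian.Ext.mk₀ (𝟙 X)

noncomputable instance instGMonoid (X : C) : GradedMonoid.GMonoid (fun i : ℕ => Abelian.Ext X X i) where
  one_mul a :=
    (mk_comp_eq (Abelian.Ext.mk₀ (𝟙 X)) a.2 rfl (zero_add a.1)).trans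
      (congrArg (Sigma.mk a.1) (Abelian.Ext.mk₀_id_comp a.2))
  mul_one a :=
    (mk_comp_eq a.2 (Abelian.Ext.mk₀ (𝟙 X)) rfl (add_zero a.1)).trans
      (congrArg (Sigma.mk a.1) (Abelian.Ext.comp_mk₀_id a.2))
  mul_assoc a b c := by
    refine (mk_comp_eq (a.2.comp b.2 rfl) c.2 rfl (add_assoc a.1 b.1 c.1)).trans ?_
    exact congrArg (Sigma.mk _)
      (Abelian.Ext.comp_assoc a.2 b.2 c.2 rfl rfl (add_assoc a.1 b.1 c.1))

/-- The Yoneda product is biadditive, so the direct sum of the `Ext X X i` is a ring. -/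
noncomputable instance instGRing (X : C) : DirectSum.GRing (fun i : ℕ => Abelian.Ext X X i) where
  toGMonoid := instGMonoid X
  mul_zero {_ j} a := Abelian.Ext.comp_zero a X j _ rfl
  zero_mul {i _} b := Abelian.Ext.zero_comp X i b _ rfl
  mul_add a b c := Abelian.Ext.comp_add a b c rfl
  add_mul a b c := Abelian.Ext.add_comp a b c rfl
  natCast m := m • Abelian.Ext.mk₀ (𝟙 X)
  natCast_zero := zero_smul _ _
  natCast_succ m := succ_nsmul _ m
  intCast m := m • Abelian.Ext.mk₀ (𝟙 X)
  intCast_ofNat m := natCast_zsmul _ m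
  intCast_negSucc_ofNat m := negSucc_zsmul _ m

variable (k : Type*) [Field k] [Linear k C]

lemma smul_mk_comp {X : C} (r : k) {i : ℕ} (x : Abelian.Ext X X i) :
    (⟨0 + i, (r • Abelian.Ext.mk₀ (𝟙 X)).comp x rfl⟩ : Σ m : ℕ, Abelian.Ext X X m) = ⟨i, r • x⟩ :=
  (mk_comp_eq (r • Abelian.Ext.mk₀ (𝟙 X)) x rfl (zero_add i)).trans
    (congrArg (Sigma.mk i) (by rw [Abelian.Ext.smul_comp, Abelian.Ext.mk₀_id_comp]))

lemma comp_smul_mk {X : C} (r : k) {i : ℕ} (x : Abelian.Ext X X i) :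
    (⟨i + 0, x.comp (r • Abelian.Ext.mk₀ (𝟙 X)) rfl⟩ : Σ m : ℕ, Abelian.Ext X X m) = ⟨i, r • x⟩ :=
  congrArg (Sigma.mk i) (by rw [Abelian.Ext.comp_smul, Abelian.Ext.comp_mk₀_id])

/-- The structure map of the `k`-algebra sends a scalar `r` to `r • 𝟙 X`. -/
noncomputable instance instGAlgebra (X : C) : DirectSum.GAlgebra k (fun i : ℕ => Abelian.Ext X X i) where
  toFun :=
    { toFun := fun r => r • Abelian.Ext.mk₀ (𝟙 X)
      map_zero' := zero_smul _ _
      map_add' := fun r s => add_smul r s _ }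
  map_one := one_smul _ _
  map_mul r s :=
    (congrArg (Sigma.mk 0) (mul_smul r s (Abelian.Ext.mk₀ (𝟙 X)))).trans
      (smul_mk_comp k r (s • Abelian.Ext.mk₀ (𝟙 X))).symm
  commutes r x := (smul_mk_comp k r x.2).trans (comp_smul_mk k r x.2).symm
  smul_def r x := (smul_mk_comp k r x.2).symm

end ExtAlg

/-- The Ext algebra `Ext^*(X, X) = ⨁ i, Ext^i(X, X)` with the Yoneda product. -/
abbrev ExtAlgebra {C : Type u} [Category.{v} C] [Abelian C] [HasExt.{w} C] (X : C) : Type w :=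
  ⨁ i : ℕ, Abelian.Ext X X i

/-! ### Gelfand-Kirillov dimension -/

/-- The polynomial growth exponent `limsup (log (d m) / log m)` of a sequence of dimensions. -/
noncomputable def growthExponent (d : ℕ → ℕ∞) : EReal :=
  Filter.limsup (fun m : ℕ => ENNReal.log (d m : ENNReal) / ((Real.log m : ℝ) : EReal))
    Filter.atTop

/-- The Gelfand-Kirillov dimension of an arbitrary `k`-algebra: the supremum, over all
finite-dimensional subspaces `V`, of the growth exponent of `dim (V^0 + V^1 + ⋯ + V^m)`. -/
noncomputable def gkDim (k : Type*) (A : Type*) [Field k] [Ring A] [Algebra k A] : EReal :=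
  ⨆ V : {V : Submodule k A // FiniteDimensional k V},
    growthExponent fun m =>
      Cardinal.toENat (Module.rank k (⨆ i ∈ Finset.range (m + 1), (V : Submodule k A) ^ i :
        Submodule k A))

/-- The Gelfand-Kirillov dimension of a graded algebra with homogeneous components `A i`,
computed from its Hilbert function: the growth exponent of `∑_{i ≤ m} dim (A i)`.
A component of infinite dimension counts as `⊤`. -/
noncomputable def gradedGKDim (k : Type*) [Field k] (A : ℕ → Type*) [∀ i, AddCommGroup (A i)]
    [∀ i, Module k (A i)] : EReal :=
  growthExponent fun m => ∑ i ∈ Finset.range (m + 1), Cardinal.toENat (Module.rank k (A i))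

/-! ### The Fomin-Kirillov algebras -/

namespace FominKirillov

/-- Labels of the generators `x_{i,j}`, `i < j`. -/
abbrev Gen (n : ℕ) : Type := {p : Fin n × Fin n // p.1 < p.2}

/-- The free generator `x_{i,j}`, `i < j`. -/
abbrev X (k : Type u) [Field k] {n : ℕ} (i j : Fin n) (h : i < j) : FreeAlgebra k (Gen n) :=
  FreeAlgebra.ι k ⟨(i, j), h⟩

/-- The defining quadratic relations: the relation `r` says that `r a b` forces `a = b`. -/
inductive Rel (k : Type u) [Field k] (n : ℕ) :
    FreeAlgebra k (Gen n) → FreeAlgebra k (Gen n) → Prop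
  | sq (i j : Fin n) (hij : i < j) : Rel k n (X k i j hij * X k i j hij) 0
  | triangle (i j l : Fin n) (hij : i < j) (hjl : j < l) :
      Rel k n (X k i j hij * X k j l hjl - X k j l hjl * X k i l (hij.trans hjl)
        - X k i l (hij.trans hjl) * X k i j hij) 0
  | triangle' (i j l : Fin n) (hij : i < j) (hjl : j < l) :
      Rel k n (X k j l hjl * X k i j hij - X k i l (hij.trans hjl) * X k j l hjl
        - X k i j hij * X k i l (hij.trans hjl)) 0
  | comm (i j l m : Fin n) (hij : i < j) (hlm : l < m)
      (hdisj : Disjoint ({i, j} : Set (Fin n)) {l, m}) :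
      Rel k n (X k i j hij * X k l m hlm - X k l m hlm * X k i j hij) 0

end FominKirillov

/-- The Fomin-Kirillov algebra `𝓔_n` over `k`. -/
abbrev FominKirillov (k : Type u) [Field k] (n : ℕ) : Type u :=
  RingQuot (FominKirillov.Rel k n)

namespace FominKirillov

variable (k : Type u) [Field k] (n : ℕ)

/-- The augmentation `𝓔_n → k`, which sends every generator to `0`. -/
noncomputable def augmentation : FominKirillov k n →ₐ[k] k :=
  RingQuot.liftAlgHom k ⟨FreeAlgebra.lift k (fun _ => (0 : k)), by
    intro a b h
    cases h <;> simp⟩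

/-- The trivial `𝓔_n`-module `k`, on which every generator acts by `0`. -/
noncomputable def trivialModule : ModuleCat.{u} (FominKirillov k n) :=
  (ModuleCat.restrictScalars (augmentation k n).toRingHom).obj (ModuleCat.of k k)

end FominKirillov

/-!
The generators `y i = x_{2i,2i+1}` of the Fomin-Kirillov algebra commute and have square zero. If
`g i` are the multiplications by the variables of the skew polynomial ring in `⌊n/2⌋` variables
(spanned by multisets of variables), then `∑ i, g i ⊗ y i` has square zero on `N`-valued skew
polynomials for every module `N`, as the `g i` anticommute. This makes `KoszulTwist.functor`, an
exact functor to modules over the dual numbers `k[ε]`, and an exact functor is multiplicative on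
Yoneda products. It takes the trivial module to the skew polynomial ring, on which `ε` acts as
zero, and (`KoszulTwist.map_extClass`) it takes the class of degree one dual to `y i` to `g i` times
the canonical periodicity class `tau`. Multiplication by powers of `tau` is injective by dimension
shifting (`SqZero.tauPow_eq_zero`), so the monomials in the classes dual to the `y i` are linearly
independent, like the monomials in the skew polynomial ring
(`KoszulTwist.exists_linearIndependent_extWord`). Hence `Ext` has, in degree `d`, at least as many
dimensions as the polynomial ring in `⌊n/2⌋` variables, in the subalgebra generated by finitely many
elements of degree one. Both bounds follow. Working with a functor instead of restricting to the
commutative subalgebra generated by the `y i` replaces the computation of its `Ext` algebra by that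
of one class over `k[ε]`.

For zero divisors, let `α`, `β`, `γ` be the classes dual to `x_{a,b}`, `x_{b,c}`, `x_{a,c}` with
`a < b < c`. A bilinear form on the span of the generators which vanishes on the defining relations
gives a module with three layers, and hence a relation between the products of classes of degree one
(`FominKirillov.extClass_comp_extClass`). In this way `α β = -β γ = -γ α` and `α γ = γ β`
(`FominKirillov.genClass_triangle₁`, `FominKirillov.genClass_triangle₂`,
`FominKirillov.genClass_triangle₃`), which imply `(α² - γ²) β = 0`. The functor of the single
element `x_{a,b}` takes `α²` to `tau²` times an injective operator and `γ` to zero, so `α² ≠ γ²`.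
-/

/-! ### Modules given by representations -/

section RepSpace

variable {k : Type u} [Field k] {A : Type u} [Ring A] [Algebra k A]
variable {V W U : Type u} [AddCommGroup V] [Module k V] [AddCommGroup W] [Module k W]
  [AddCommGroup U] [Module k U]

/-- The vector space `V`, regarded as an `A`-module through the representation `ρ`. -/
def RepSpace (_ρ : A →ₐ[k] Module.End k V) : Type u := V

namespace RepSpace

variable (ρ : A →ₐ[k] Module.End k V) (σ : A →ₐ[k] Module.End k W) (τ : A →ₐ[k] Module.End k U)

instance : AddCommGroup (RepSpace ρ) := inferInstanceAs (AddCommGroup V)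
instance : Module A (RepSpace ρ) := Module.compHom V ρ.toRingHom

/-- The `k`-module structure is restricted from `A`, as it is on every object of `ModuleCat A`. -/
instance : Module k (RepSpace ρ) := Module.restrictScalars k A (RepSpace ρ)

instance : IsScalarTower k A (RepSpace ρ) := IsScalarTower.restrictScalars k A (RepSpace ρ)

/-- The identity map from `V` to the `A`-module it underlies. -/
def mk : V ≃ₗ[k] RepSpace ρ where
  toFun v := v
  invFun v := v
  map_add' _ _ := rfl
  map_smul' r v := (LinearMap.congr_fun (AlgHom.commutes ρ r) v).symm

lemma smul_mk (a : A) (v : V) : a • mk ρ v = mk ρ (ρ a v) := rfl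

variable {ρ σ τ}

/-- An intertwining operator as a morphism of `A`-modules. -/
noncomputable def hom (f : V →ₗ[k] W) (hf : ∀ a v, f (ρ a v) = σ a (f v)) :
    ModuleCat.of A (RepSpace ρ) ⟶ ModuleCat.of A (RepSpace σ) :=
  ModuleCat.ofHom
    { toFun := fun v => mk σ (f ((mk ρ).symm v))
      map_add' := fun v w => by simp
      map_smul' := fun a v => by
        obtain ⟨v, rfl⟩ := (mk ρ).surjective v
        simp [smul_mk, hf] }

/-- The linear map underlying a morphism of `A`-modules. -/
noncomputable def lin (f : ModuleCat.of A (RepSpace ρ) ⟶ ModuleCat.of A (RepSpace σ)) :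
    V →ₗ[k] W where
  toFun v := (mk σ).symm (f.hom (mk ρ v))
  map_add' v w := by simp
  map_smul' r v := by
    simp only [map_smul, RingHom.id_apply]
    rw [← algebraMap_smul A, map_smul, algebraMap_smul, map_smul]

lemma lin_comp (f : ModuleCat.of A (RepSpace ρ) ⟶ ModuleCat.of A (RepSpace σ))
    (g : ModuleCat.of A (RepSpace σ) ⟶ ModuleCat.of A (RepSpace τ)) :
    lin (f ≫ g) = lin g ∘ₗ lin f := rfl

lemma lin_zero : lin (0 : ModuleCat.of A (RepSpace ρ) ⟶ ModuleCat.of A (RepSpace σ)) = 0 := rfl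

lemma lin_add (f g : ModuleCat.of A (RepSpace ρ) ⟶ ModuleCat.of A (RepSpace σ)) :
    lin (f + g) = lin f + lin g := rfl

lemma lin_smul (r : k) (f : ModuleCat.of A (RepSpace ρ) ⟶ ModuleCat.of A (RepSpace σ)) :
    lin (r • f) = r • lin f :=
  LinearMap.ext fun v => (mk σ).symm.map_smul r (f.hom (mk ρ v))

lemma lin_injective {f g : ModuleCat.of A (RepSpace ρ) ⟶ ModuleCat.of A (RepSpace σ)}
    (h : lin f = lin g) : f = g :=
  ModuleCat.hom_ext (LinearMap.ext fun v => LinearMap.congr_fun h v)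

lemma lin_apply_rep (f : ModuleCat.of A (RepSpace ρ) ⟶ ModuleCat.of A (RepSpace σ)) (a : A)
    (v : V) : lin f (ρ a v) = σ a (lin f v) :=
  f.hom.map_smul a (mk ρ v)

end RepSpace

end RepSpace

/-! ### Modules over the dual numbers -/

namespace SqZero

open scoped DualNumber
open RepSpace

variable {k : Type u} [Field k]
variable {V W U : Type u} [AddCommGroup V] [Module k V] [AddCommGroup W] [Module k W]
  [AddCommGroup U] [Module k U]

/-- The representation of `k[ε]` on `V` in which `ε` acts by the operator `T` of square zero. -/
noncomputable def rep (T : Module.End k V) (hT : T * T = 0) : k[ε] →ₐ[k] Module.End k V :=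
  DualNumber.lift ⟨(Algebra.ofId k _, T), hT, fun a => (Algebra.commutes a T).symm⟩

lemma rep_apply (T : Module.End k V) (hT : T * T = 0) (a : k[ε]) (v : V) :
    rep T hT a v = a.fst • v + a.snd • T v := rfl

lemma rep_eps (T : Module.End k V) (hT : T * T = 0) : rep T hT DualNumber.eps = T :=
  DualNumber.lift_apply_eps _

/-- The `k[ε]`-module with underlying space `V` on which `ε` acts by `T`. -/
noncomputable abbrev mod (T : Module.End k V) (hT : T * T = 0) : ModuleCat.{u} k[ε] :=
  ModuleCat.of k[ε] (RepSpace (rep T hT))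

/-- A linear map intertwining the operators, as a morphism of `k[ε]`-modules. -/
noncomputable def hom {T : Module.End k V} {hT : T * T = 0} {T' : Module.End k W}
    {hT' : T' * T' = 0} (f : V →ₗ[k] W) (hf : ∀ v, f (T v) = T' (f v)) : mod T hT ⟶ mod T' hT' :=
  RepSpace.hom f fun a v => by simp [rep_apply, hf]

lemma lin_hom {T : Module.End k V} {hT : T * T = 0} {T' : Module.End k W}
    {hT' : T' * T' = 0} (f : V →ₗ[k] W) (hf : ∀ v, f (T v) = T' (f v)) :
    lin (hom (hT := hT) (hT' := hT') f hf) = f := rfl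

lemma lin_comm {T : Module.End k V} {hT : T * T = 0} {T' : Module.End k W}
    {hT' : T' * T' = 0} (f : mod T hT ⟶ mod T' hT') (v : V) : lin f (T v) = T' (lin f v) := by
  have h := lin_apply_rep f DualNumber.eps v
  rwa [rep_eps, rep_eps] at h

variable (k V) in
/-- The operator `(a, b) ↦ (0, a)`, giving `V × V` the structure of the free
`k[ε]`-module `V ⊗ k[ε]`. -/
def shift : Module.End k (V × V) :=
  LinearMap.inr k V V ∘ₗ LinearMap.fst k V V

@[simp] lemma shift_apply (p : V × V) : shift k V p = (0, p.1) := rfl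

lemma shift_mul_shift : shift k V * shift k V = 0 := by
  ext <;> simp

lemma inr_intertwines {T : Module.End k V} (h0 : T = 0) (v : V) :
    LinearMap.inr k V V (T v) = shift k V (LinearMap.inr k V V v) := by
  simp [h0]

lemma fst_intertwines {T : Module.End k V} (h0 : T = 0) (p : V × V) :
    LinearMap.fst k V V (shift k V p) = T (LinearMap.fst k V V p) := by
  simp [h0]

lemma prodMap_intertwines (g : V →ₗ[k] V) (p : V × V) :
    g.prodMap g (shift k V p) = shift k V (g.prodMap g p) := by
  simp

variable (k V) in
/-- The free `k[ε]`-module `V ⊗ k[ε]`. -/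
noncomputable abbrev free : ModuleCat.{u} k[ε] := mod (shift k V) shift_mul_shift

/-- A morphism from `V ⊗ k[ε]` is `(a, b) ↦ h a + ε • h b` for a linear map `h` on `V`, so it
lifts along an epimorphism because `h` does. -/
instance : Projective (free k V) where
  factors {E X} f e he := by
    have hs : Function.Surjective e.hom := (ModuleCat.epi_iff_surjective e).1 he
    let _ : Module k E := Module.compHom E (algebraMap k k[ε])
    let _ : Module k X := Module.compHom X (algebraMap k k[ε])
    let m : (V × V) ≃ₗ[k] RepSpace (rep (shift k V) shift_mul_shift) :=
      RepSpace.mk (rep (shift k V) shift_mul_shift)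
    have hm (c : k[ε]) (a b : V) : c • m (a, b) = m (c.fst • a, c.fst • b + c.snd • a) := by
      change m (rep (shift k V) shift_mul_shift c (a, b)) = _
      rw [rep_apply]; simp
    let e' : E →ₗ[k] X :=
      { toFun := e.hom, map_add' := e.hom.map_add, map_smul' := fun r v => e.hom.map_smul _ v }
    let f' : V →ₗ[k] X :=
      { toFun := fun v => f.hom (m (v, 0))
        map_add' := fun v w => by
          rw [← f.hom.map_add, ← map_add]; simp
        map_smul' := fun r v => by
          refine Eq.trans ?_ (f.hom.map_smul (algebraMap k k[ε] r) (m (v, 0)))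
          rw [hm]; simp [TrivSqZeroExt.algebraMap_eq_inl] }
    obtain ⟨h, hh⟩ := Module.projective_lifting_property e' f' hs
    have hh' (v : V) : e.hom (h v) = f.hom (m (v, 0)) := LinearMap.congr_fun hh v
    have hf (a b : V) : f.hom (m (a, b)) =
        f.hom (m (a, 0)) + (DualNumber.eps : k[ε]) • f.hom (m (b, 0)) := by
      rw [← f.hom.map_smul, ← f.hom.map_add, hm, ← map_add]
      simp
    have hk (r : k) (v : V) : h (r • v) = (algebraMap k k[ε] r) • h v := h.map_smul r v
    refine ⟨ModuleCat.ofHom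
      { toFun := fun p => h (m.symm p).1 + (DualNumber.eps : k[ε]) • h (m.symm p).2
        map_add' := fun p q => ?_
        map_smul' := fun c p => ?_ }, ?_⟩
    · simp only [map_add, Prod.fst_add, Prod.snd_add, smul_add]; abel
    · obtain ⟨⟨a, b⟩, rfl⟩ := m.surjective p
      rw [hm]
      simp only [LinearEquiv.symm_apply_apply, RingHom.id_apply]
      have hc : c = algebraMap k k[ε] c.fst + algebraMap k k[ε] c.snd * DualNumber.eps := by
        ext <;> simp [TrivSqZeroExt.algebraMap_eq_inl]
      rw [map_add, hk, hk, hk]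
      conv_rhs => rw [hc]
      simp only [smul_add, add_smul, ← mul_smul, add_mul]
      rw [mul_comm _ (algebraMap k k[ε] c.fst), mul_comm _ (algebraMap k k[ε] c.snd),
        mul_assoc _ DualNumber.eps DualNumber.eps, DualNumber.eps_mul_eps, mul_zero, zero_smul]
      abel
    · refine ModuleCat.hom_ext (LinearMap.ext fun p => ?_)
      obtain ⟨⟨a, b⟩, rfl⟩ := m.surjective p
      simp only [ModuleCat.hom_comp, LinearMap.comp_apply, ModuleCat.hom_ofHom, LinearMap.coe_mk,
        AddHom.coe_mk, LinearEquiv.symm_apply_apply]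
      rw [map_add, map_smul, hh', hh', ← hf]

section Tau

variable (T : Module.End k V) (hT : T * T = 0) (h0 : T = 0)

/-- The extension `0 → V → V ⊗ k[ε] → V → 0` of a module with `ε • V = 0` by itself. -/
noncomputable abbrev freeSeq : ShortComplex (ModuleCat.{u} k[ε]) where
  X₁ := mod T hT
  X₂ := free k V
  X₃ := mod T hT
  f := hom (LinearMap.inr k V V) (inr_intertwines h0)
  g := hom (LinearMap.fst k V V) (fst_intertwines h0)
  zero := lin_injective (by
    rw [lin_comp, SqZero.lin_hom, SqZero.lin_hom, lin_zero, LinearMap.fst_comp_inr])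

lemma freeSeq_shortExact : (freeSeq T hT h0).ShortExact where
  exact := by
    rw [ShortComplex.moduleCat_exact_iff]
    intro p h
    obtain ⟨⟨a, b⟩, rfl⟩ := (RepSpace.mk (rep (shift k V) shift_mul_shift)).surjective p
    obtain rfl : a = 0 := h
    exact ⟨RepSpace.mk (rep T hT) b, rfl⟩
  mono_f := (ModuleCat.mono_iff_injective _).2 (LinearMap.inr_injective (R := k) (M := V) (M₂ := V))
  epi_g := (ModuleCat.epi_iff_surjective _).2 (LinearMap.fst_surjective (R := k) (M := V) (M₂ := V))

open Abelian

/-- The class of `freeSeq`; for `V = k` it generates the `Ext` algebra of `k` over `k[ε]`. -/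
noncomputable def tau : Ext (mod T hT) (mod T hT) 1 := (freeSeq_shortExact T hT h0).extClass

/-- The product of the `d`-th power of `tau` with an endomorphism. -/
noncomputable def tauPow (d : ℕ) (g : mod T hT ⟶ mod T hT) : Ext (mod T hT) (mod T hT) d :=
  match d with
  | 0 => Ext.mk₀ g
  | d + 1 => (tau T hT h0).comp (tauPow d g) (add_comm 1 d)

lemma mk₀_comp_tau (g : mod T hT ⟶ mod T hT) :
    (Ext.mk₀ g).comp (tau T hT h0) (zero_add 1) = (tau T hT h0).comp (Ext.mk₀ g) (add_zero 1) :=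
  ((freeSeq_shortExact T hT h0).extClass_naturality (freeSeq_shortExact T hT h0)
    { τ₁ := g
      τ₂ := hom ((lin g).prodMap (lin g)) (prodMap_intertwines _)
      τ₃ := g
      comm₁₂ := lin_injective (by
        rw [lin_comp, lin_comp, SqZero.lin_hom, SqZero.lin_hom]; ext <;> simp)
      comm₂₃ := lin_injective (by
        rw [lin_comp, lin_comp, SqZero.lin_hom, SqZero.lin_hom]; ext <;> simp) }).symm

lemma mk₀_comp_tauPow (d : ℕ) (g h : mod T hT ⟶ mod T hT) :
    (Ext.mk₀ g).comp (tauPow T hT h0 d h) (zero_add d) = tauPow T hT h0 d (g ≫ h) := by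
  induction d with
  | zero => simp [tauPow]
  | succ d ih =>
    rw [tauPow, tauPow, ← Ext.comp_assoc _ _ _ (zero_add 1) (add_comm 1 d) (by omega),
      mk₀_comp_tau, Ext.comp_assoc _ _ _ (add_zero 1) (zero_add d) (by omega), ih]

lemma tauPow_one_comp (d : ℕ) (g h : mod T hT ⟶ mod T hT) :
    (tauPow T hT h0 1 g).comp (tauPow T hT h0 d h) (add_comm 1 d) =
      tauPow T hT h0 (d + 1) (g ≫ h) := by
  rw [tauPow, tauPow, tauPow, ← mk₀_comp_tauPow,
    ← Ext.comp_assoc (tau T hT h0) (Ext.mk₀ g) (tauPow T hT h0 d h) (add_zero 1) (zero_add d)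
      (by omega)]

lemma tauPow_add (d : ℕ) (g h : mod T hT ⟶ mod T hT) :
    tauPow T hT h0 d (g + h) = tauPow T hT h0 d g + tauPow T hT h0 d h := by
  induction d with
  | zero => exact Ext.mk₀_add g h
  | succ d ih => rw [tauPow, ih, Ext.comp_add]; rfl

lemma tauPow_smul (d : ℕ) (r : k) (g : mod T hT ⟶ mod T hT) :
    tauPow T hT h0 d (r • g) = r • tauPow T hT h0 d g := by
  induction d with
  | zero => rw [tauPow, tauPow, Ext.mk₀_smul]
  | succ d ih => rw [tauPow, ih, Ext.comp_smul]; rfl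

/-- Dimension shifting: multiplication by `tau` is injective, since the middle term of `freeSeq`
is projective and, in degree `0`, since morphisms from it to `V` kill the image of `ε`. -/
lemma tauPow_eq_zero (d : ℕ) (g : mod T hT ⟶ mod T hT) (h : tauPow T hT h0 d g = 0) : g = 0 := by
  induction d with
  | zero => exact (Ext.mk₀_eq_zero_iff g).1 h
  | succ d ih =>
    obtain ⟨x, hx⟩ :=
      Ext.contravariant_sequence_exact₁ (freeSeq_shortExact T hT h0) _ (tauPow T hT h0 d g)
        (add_comm 1 d) h
    refine ih ?_
    rw [← hx]
    cases d with
    | zero =>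
      obtain ⟨p, rfl⟩ := (Ext.mk₀_bijective _ _).2 x
      rw [Ext.mk₀_comp_mk₀, Ext.mk₀_eq_zero_iff]
      refine lin_injective (LinearMap.ext fun v => ?_)
      -- `(0, v) = ε • (v, 0)` goes to an element of `ε • V = 0`.
      have := lin_comm (T := shift k V) (hT := shift_mul_shift) (T' := T) (hT' := hT) p (v, 0)
      exact this.trans (LinearMap.congr_fun h0 _)
    | succ d =>
      have : x = 0 := Ext.eq_zero_of_projective (P := free k V) x
      rw [this, Ext.comp_zero]

/-- `tauPow` as a linear map. -/
noncomputable def tauPowₗ (d : ℕ) : (mod T hT ⟶ mod T hT) →ₗ[k] Ext (mod T hT) (mod T hT) d where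
  toFun := tauPow T hT h0 d
  map_add' := tauPow_add T hT h0 d
  map_smul' := tauPow_smul T hT h0 d

lemma tauPowₗ_injective (d : ℕ) : Function.Injective (tauPowₗ T hT h0 d) :=
  (injective_iff_map_eq_zero _).2 (tauPow_eq_zero T hT h0 d)

end Tau

end SqZero

/-! ### The Koszul twist of a module -/

/-- The summands `g i y i g j y j` and `g j y j g i y i` cancel for `i ≠ j`, and vanish for
`i = j`. -/
lemma sum_mul_sq_eq_zero {R ι : Type*} [Ring R] [Fintype ι] (g y : ι → R)
    (hg : ∀ i j, i ≠ j → g i * g j = -(g j * g i)) (hy : ∀ i j, Commute (y i) (y j))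
    (hsq : ∀ i, y i * y i = 0) (hgy : ∀ i j, Commute (g i) (y j)) :
    (∑ i, g i * y i) * (∑ i, g i * y i) = 0 := by
  classical
  have key (i j : ι) : g i * y i * (g j * y j) = g i * g j * (y i * y j) := by
    rw [mul_assoc, ← mul_assoc (y i), ← (hgy j i).eq]; simp only [mul_assoc]
  rw [Finset.sum_mul_sum, ← Finset.sum_product']
  refine Finset.sum_involution (fun p _ => p.swap) ?_ ?_ (by simp) (by simp)
  · rintro ⟨i, j⟩ -
    simp only [Prod.swap, key]
    by_cases h : i = j
    · subst h; simp [hsq]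
    · rw [hg i j h, (hy i j).eq]; simp
  · rintro ⟨i, j⟩ - h e
    obtain rfl : j = i := congrArg Prod.fst e
    exact h (by simp [key, hsq])

namespace KoszulTwist

variable {k : Type u} [Field k] {A : Type u} [Ring A] [Algebra k A]
variable {ι : Type} [LinearOrder ι]

section

variable (k) (N : Type u) [AddCommGroup N] [Module k N]

/-- Multiplication by the variable `i` on the ring of skew polynomials in the variables `ι`, with
coefficients in `N`: a monomial is a multiset of variables, and moving `i` past each smaller
variable costs a sign. -/
noncomputable def skewMul (i : ι) : Module.End k (Multiset ι →₀ N) :=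
  Finsupp.lsum k fun s => ((-1 : k) ^ s.countP (· < i)) • Finsupp.lsingle (i ::ₘ s)

@[simp] lemma skewMul_single (i : ι) (s : Multiset ι) (v : N) :
    skewMul k N i (Finsupp.single s v) =
      ((-1 : k) ^ s.countP (· < i)) • Finsupp.single (i ::ₘ s) v := by
  simp [skewMul]

lemma skewMul_anticomm (i j : ι) (h : i ≠ j) :
    skewMul k N i * skewMul k N j = -(skewMul k N j * skewMul k N i) := by
  wlog hij : i < j generalizing i j
  · rw [this j i h.symm (lt_of_le_of_ne (not_lt.1 hij) h.symm), neg_neg]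
  ext s v : 2
  simp only [LinearMap.comp_apply, Module.End.mul_apply, Finsupp.lsingle_apply, skewMul_single,
    map_smul, LinearMap.neg_apply, Multiset.countP_cons, hij, not_lt.2 hij.le, if_true, if_false,
    add_zero, Multiset.cons_swap j i, smul_smul, ← neg_smul]
  congr 1
  ring

variable {k N} {N' : Type u} [AddCommGroup N'] [Module k N']

lemma mapRange_skewMul (f : N →ₗ[k] N') (i : ι) (v : Multiset ι →₀ N) :
    Finsupp.mapRange.linearMap f (skewMul k N i v) =
      skewMul k N' i (Finsupp.mapRange.linearMap f v) := by
  induction v using Finsupp.induction_linear with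
  | zero => simp
  | add v w hv hw => simp only [map_add, hv, hw]
  | single s v =>
    simp only [skewMul_single, map_smul, Finsupp.mapRange.linearMap_apply, Finsupp.mapRange_single]

end

section

variable [Fintype ι] (y : ι → A) (N : Type u) [AddCommGroup N] [Module k N] [Module A N]
  [IsScalarTower k A N]

/-- The operator `∑ i, g i ⊗ y i` on the skew polynomials with coefficients in `N`, where `g i` is
multiplication by the `i`-th variable. -/
noncomputable def twist : Module.End k (Multiset ι →₀ N) :=
  ∑ i, skewMul k N i * Finsupp.mapRange.linearMap (Algebra.lsmul k k N (y i))

lemma twist_apply (v : Multiset ι →₀ N) :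
    twist (k := k) y N v =
      ∑ i, skewMul k N i (Finsupp.mapRange.linearMap (Algebra.lsmul k k N (y i)) v) := by
  simp [twist, LinearMap.sum_apply]

variable {y} in
lemma twist_mul_twist (hc : ∀ i j, Commute (y i) (y j)) (hsq : ∀ i, y i * y i = 0) :
    twist (k := k) y N * twist y N = 0 := by
  have hmul (a b : A) :
      (Finsupp.mapRange.linearMap (Algebra.lsmul k k N a) : Module.End k (Multiset ι →₀ N)) *
        Finsupp.mapRange.linearMap (Algebra.lsmul k k N b) =
      Finsupp.mapRange.linearMap (Algebra.lsmul k k N (a * b)) := by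
    rw [map_mul]; exact (Finsupp.mapRange.linearMap_comp _ _).symm
  refine sum_mul_sq_eq_zero _ _ (skewMul_anticomm k N) (fun i j => ?_) (fun i => ?_) fun i j => ?_
  · rw [commute_iff_eq, hmul, hmul, (hc i j).eq]
  · rw [hmul, hsq, map_zero]; ext; simp
  · exact LinearMap.ext fun v => (mapRange_skewMul _ _ _).symm

variable {N} {N' : Type u} [AddCommGroup N'] [Module k N'] [Module A N'] [IsScalarTower k A N']

lemma mapRange_twist (f : N →ₗ[k] N') (hf : ∀ i v, f (y i • v) = y i • f v)
    (v : Multiset ι →₀ N) :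
    Finsupp.mapRange.linearMap f (twist (k := k) y N v) =
      twist (k := k) y N' (Finsupp.mapRange.linearMap f v) := by
  rw [twist_apply, twist_apply, map_sum]
  refine Finset.sum_congr rfl fun i _ => ?_
  rw [mapRange_skewMul]
  congr 1
  ext s
  simp [hf]

end

open scoped ModuleCat DualNumber

variable [Fintype ι] {y : ι → A} (hc : ∀ i j, Commute (y i) (y j)) (hsq : ∀ i, y i * y i = 0)

variable (k) in
/-- The `k[ε]`-module of skew polynomials with coefficients in `N`, on which `ε` acts by `twist`. -/
noncomputable abbrev obj (N : ModuleCat.{u} A) : ModuleCat.{u} k[ε] :=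
  SqZero.mod (twist (k := k) y N) (twist_mul_twist N hc hsq)

variable (k) in
/-- The coefficientwise action of a morphism on skew polynomials. -/
noncomputable def map {N N' : ModuleCat.{u} A} (f : N ⟶ N') : obj k hc hsq N ⟶ obj k hc hsq N' :=
  SqZero.hom (Finsupp.mapRange.linearMap (f.hom.restrictScalars k))
    (mapRange_twist y _ fun i v => f.hom.map_smul (y i) v)

lemma lin_map {N N' : ModuleCat.{u} A} (f : N ⟶ N') :
    RepSpace.lin (map k hc hsq f) =
      Finsupp.mapRange.linearMap (f.hom.restrictScalars k) := rfl

lemma map_comp {N N' N'' : ModuleCat.{u} A} (f : N ⟶ N') (g : N' ⟶ N'') :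
    map k hc hsq (f ≫ g) = map k hc hsq f ≫ map k hc hsq g :=
  RepSpace.lin_injective (by
    rw [RepSpace.lin_comp, lin_map, lin_map, lin_map, ← Finsupp.mapRange.linearMap_comp]; rfl)

lemma map_add {N N' : ModuleCat.{u} A} (f g : N ⟶ N') :
    map k hc hsq (f + g) = map k hc hsq f + map k hc hsq g :=
  RepSpace.lin_injective (by
    rw [RepSpace.lin_add, lin_map, lin_map, lin_map]
    ext; simp)

lemma map_smul {N N' : ModuleCat.{u} A} (r : k) (f : N ⟶ N') :
    map k hc hsq (r • f) = r • map k hc hsq f :=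
  RepSpace.lin_injective (by
    rw [RepSpace.lin_smul, lin_map, lin_map]
    ext; simp)

variable (k) in
/-- Commuting elements `y i` of square zero in `A` give an exact functor from `A`-modules to
`k[ε]`-modules: `N` goes to the skew polynomials with coefficients in `N`, and `ε` acts by `twist`,
whose square vanishes because the variables anticommute. -/
noncomputable def functor : ModuleCat.{u} A ⥤ ModuleCat.{u} k[ε] where
  obj N := obj k hc hsq N
  map f := map k hc hsq f
  map_id _ := RepSpace.lin_injective Finsupp.mapRange.linearMap_id
  map_comp f g := map_comp hc hsq f g

instance : (functor k hc hsq).Additive where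
  map_add {_ _ f g} := map_add hc hsq f g

instance : (functor k hc hsq).Linear k where
  map_smul f r := map_smul hc hsq r f

lemma functor_map_shortExact (S : ShortComplex (ModuleCat.{u} A)) (hS : S.ShortExact) :
    (S.map (functor k hc hsq)).ShortExact where
  exact := by
    rw [ShortComplex.moduleCat_exact_iff]
    intro v hv
    have hex := (ShortComplex.moduleCat_exact_iff S).1 hS.exact
    let m₁ := RepSpace.mk (SqZero.rep (twist (k := k) y S.X₁) (twist_mul_twist _ hc hsq))
    let m₂ := RepSpace.mk (SqZero.rep (twist (k := k) y S.X₂) (twist_mul_twist _ hc hsq))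
    obtain ⟨v, rfl⟩ := m₂.surjective v
    have h0 : Finsupp.mapRange.linearMap (S.g.hom.restrictScalars k) v = 0 := hv
    have : v ∈ Set.range (Finsupp.mapRange S.f.hom S.f.hom.map_zero :
        (Multiset ι →₀ S.X₁) → (Multiset ι →₀ S.X₂)) := by
      rw [Finsupp.range_mapRange]
      intro s
      obtain ⟨x, hx⟩ := hex (v s) (DFunLike.congr_fun h0 s)
      exact ⟨x, hx⟩
    obtain ⟨x, hx⟩ := this
    exact ⟨m₁ x, congrArg m₂ hx⟩
  mono_f := (ModuleCat.mono_iff_injective _).2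
    (Finsupp.mapRange_injective _ S.f.hom.map_zero hS.moduleCat_injective_f)
  epi_g := (ModuleCat.epi_iff_surjective _).2
    (Finsupp.mapRange_surjective _ S.g.hom.map_zero hS.moduleCat_surjective_g)

lemma functor_preserves : Limits.PreservesFiniteLimits (functor k hc hsq) ∧
    Limits.PreservesFiniteColimits (functor k hc hsq) := by
  have h := (functor k hc hsq).exact_tfae.out 0 3
  exact h.1 (functor_map_shortExact hc hsq)

instance : Limits.PreservesFiniteLimits (functor k hc hsq) := (functor_preserves hc hsq).1

instance : Limits.PreservesFiniteColimits (functor k hc hsq) := (functor_preserves hc hsq).2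

end KoszulTwist

/-! ### Linear independence of monomials in extension classes -/

namespace KoszulTwist

open Abelian
open scoped ModuleCat DualNumber

variable {k : Type u} [Field k] {A : Type u} [Ring A] [Algebra k A]
variable {ι : Type} [LinearOrder ι] [Fintype ι] {y : ι → A}
  (hc : ∀ i j, Commute (y i) (y j)) (hsq : ∀ i, y i * y i = 0)
  {T : ModuleCat.{u} A}

lemma twist_eq_zero (hT : ∀ i (v : T), y i • v = 0) : twist (k := k) y T = 0 := by
  refine LinearMap.ext fun v => ?_
  rw [twist_apply]
  refine Finset.sum_eq_zero fun i _ => ?_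
  have : Finsupp.mapRange.linearMap (Algebra.lsmul k k T (y i)) v = 0 := by
    ext s; simp [hT]
  rw [this, _root_.map_zero]

lemma intertwines_of_eq_zero {V : Type u} [AddCommGroup V] [Module k V] {S : Module.End k V}
    (h : S = 0) (g : V →ₗ[k] V) (v : V) : g (S v) = S (g v) := by
  simp [h]

variable (hT : ∀ i (v : T), y i • v = 0)

variable (k) in
/-- The endomorphism `∑ i, c i • g i` of the skew polynomials with coefficients in `T`, where `g i`
is multiplication by the `i`-th variable. -/
noncomputable def linComb (c : ι → k) : obj k hc hsq T ⟶ obj k hc hsq T :=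
  SqZero.hom (∑ i, c i • skewMul k T i) (intertwines_of_eq_zero (twist_eq_zero hT) _)

lemma lin_linComb (c : ι → k) :
    RepSpace.lin (linComb k hc hsq hT c) = ∑ i, c i • skewMul k T i := rfl

lemma linComb_zero : linComb k hc hsq hT 0 = 0 :=
  RepSpace.lin_injective (by rw [lin_linComb]; simp; rfl)

lemma lin_linComb_single (i : ι) :
    RepSpace.lin (linComb k hc hsq hT (Pi.single i 1)) = skewMul k T i := by
  rw [lin_linComb, Finset.sum_eq_single i] <;> simp +contextual

/-- An extension of `T` by itself which splits over `k`, and on which `y i` acts as `c i` from the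
quotient to the submodule, goes to `tau` times the multiplication by `∑ i, c i • g i`. -/
lemma map_extClass {M : ModuleCat.{u} A} (f : T ⟶ M) (g : M ⟶ T) (w : f ≫ g = 0)
    (hS : (ShortComplex.mk f g w).ShortExact) (s : T →ₗ[k] M) (hs : ∀ v, g.hom (s v) = v)
    (c : ι → k) (hy : ∀ i v, y i • s v = f.hom (c i • v)) :
    hS.extClass.mapExactFunctor (functor k hc hsq) =
      SqZero.tauPow _ (twist_mul_twist T hc hsq) (twist_eq_zero hT) 1
        (linComb k hc hsq hT c) := by
  rw [Ext.mapExactFunctor_extClass]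
  let L := Finsupp.mapRange.linearMap (α := Multiset ι) (f.hom.restrictScalars k)
  let R := Finsupp.mapRange.linearMap (α := Multiset ι) s
  have hL (v) : twist (k := k) y M (L v) = 0 := by
    rw [← mapRange_twist y _ fun i v => f.hom.map_smul (y i) v, twist_eq_zero hT]
    simp
  have hR (v) : twist (k := k) y M (R v) = L ((∑ i, c i • skewMul k T i) v) := by
    rw [twist_apply, LinearMap.sum_apply, map_sum]
    refine Finset.sum_congr rfl fun i _ => ?_
    rw [LinearMap.smul_apply, _root_.map_smul, mapRange_skewMul, ← _root_.map_smul]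
    congr 1
    ext t
    have := hy i (v t)
    simpa [L, R] using this
  let G : (Multiset ι →₀ T) →ₗ[k] (Multiset ι →₀ T) := ∑ i, c i • skewMul k T i
  -- `M` splits over `k` as `s(T) ⊕ f(T)`, and `ε • (s v) = f (G v)`, so the free module on `T` maps
  -- to the twist of `M` by lifting its generators along `s`.
  let τ₂ : ((Multiset ι →₀ T) × (Multiset ι →₀ T)) →ₗ[k] (Multiset ι →₀ M) := R.coprod (L ∘ₗ G)
  have hτ₂ (p) : τ₂ (SqZero.shift k _ p) = twist (k := k) y M (τ₂ p) := by
    simp [τ₂, hL, hR, G]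
  have nat := (SqZero.freeSeq_shortExact _ (twist_mul_twist T hc hsq)
      (twist_eq_zero hT)).extClass_naturality (hS.map_of_exact (functor k hc hsq))
    { τ₁ := linComb k hc hsq hT c
      τ₂ := SqZero.hom (hT' := twist_mul_twist M hc hsq) τ₂ hτ₂
      τ₃ := 𝟙 _
      comm₁₂ := by
        refine RepSpace.lin_injective (LinearMap.ext fun v => ?_)
        change L (G v) = R 0 + L (G v)
        simp
      comm₂₃ := by
        refine RepSpace.lin_injective (LinearMap.ext fun p => ?_)
        change Finsupp.mapRange.linearMap (g.hom.restrictScalars k) (R p.1 + L (G p.2)) = p.1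
        have h1 (v) : Finsupp.mapRange.linearMap (g.hom.restrictScalars k) (R v) = v := by
          ext t; simp [R, hs]
        have h2 (v) : Finsupp.mapRange.linearMap (g.hom.restrictScalars k) (L v) = 0 := by
          ext t
          simpa [L] using LinearMap.congr_fun (congrArg ModuleCat.Hom.hom w) (v t)
        rw [_root_.map_add, h1, h2, add_zero] }
  exact (Ext.mk₀_id_comp _).symm.trans nat.symm

/-- The product `x (w 0) * x (w 1) * ⋯ * x (w (d - 1))` in the `Ext` algebra. -/
noncomputable def extWord (x : ι → Ext T T 1) : (d : ℕ) → (Fin d → ι) → Ext T T d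
  | 0, _ => Ext.mk₀ (𝟙 T)
  | d + 1, w => (x (w 0)).comp (extWord x d (Fin.tail w)) (add_comm 1 d)

/-- The composite of the multiplications by the variables `w 0`, ..., `w (d - 1)`, that by `w 0`
being applied first. -/
noncomputable def skewWord : (d : ℕ) → (Fin d → ι) → (obj k hc hsq T ⟶ obj k hc hsq T)
  | 0, _ => 𝟙 _
  | d + 1, w => linComb k hc hsq hT (Pi.single (w 0) 1) ≫ skewWord d (Fin.tail w)

lemma map_comp_eq_tauPow {d : ℕ} {a : Ext T T 1} {b : Ext T T d}
    {g h : obj k hc hsq T ⟶ obj k hc hsq T}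
    (ha : a.mapExactFunctor (functor k hc hsq) =
      SqZero.tauPow _ (twist_mul_twist T hc hsq) (twist_eq_zero hT) 1 g)
    (hb : b.mapExactFunctor (functor k hc hsq) =
      SqZero.tauPow _ (twist_mul_twist T hc hsq) (twist_eq_zero hT) d h) :
    (a.comp b (add_comm 1 d)).mapExactFunctor (functor k hc hsq) =
      SqZero.tauPow _ (twist_mul_twist T hc hsq) (twist_eq_zero hT) (d + 1) (g ≫ h) := by
  rw [Ext.mapExactFunctor_comp, ha, hb]
  exact SqZero.tauPow_one_comp _ _ _ d g h

section

variable (x : ι → Ext T T 1)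
  (hx : ∀ i, (x i).mapExactFunctor (functor k hc hsq) =
    SqZero.tauPow _ (twist_mul_twist T hc hsq) (twist_eq_zero hT) 1
      (linComb k hc hsq hT (Pi.single i 1)))

include hx in
lemma map_extWord (d : ℕ) (w : Fin d → ι) :
    (extWord x d w).mapExactFunctor (functor k hc hsq) =
      SqZero.tauPow _ (twist_mul_twist T hc hsq) (twist_eq_zero hT) d
        (skewWord hc hsq hT d w) := by
  induction d with
  | zero =>
    rw [extWord, Ext.mapExactFunctor_mk₀]
    exact congrArg Ext.mk₀ ((functor k hc hsq).map_id T)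
  | succ d ih => exact map_comp_eq_tauPow hc hsq hT (hx _) (ih _)

lemma skewWord_single (d : ℕ) (w : Fin d → ι) (s : Multiset ι) (v : T) :
    ∃ r : k, r ≠ 0 ∧ RepSpace.lin (skewWord (k := k) hc hsq hT d w) (Finsupp.single s v) =
      (r • Finsupp.single (Multiset.ofList (List.ofFn w) + s) v : Multiset ι →₀ T) := by
  induction d generalizing s with
  | zero =>
    refine ⟨1, one_ne_zero, ?_⟩
    simp only [List.ofFn_zero, Multiset.coe_nil, zero_add, one_smul]
    rfl
  | succ d ih =>
    obtain ⟨r, hr, h⟩ := ih (Fin.tail w) (w 0 ::ₘ s)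
    refine ⟨(-1) ^ s.countP (· < w 0) * r, mul_ne_zero (pow_ne_zero _ (by simp)) hr, ?_⟩
    rw [skewWord, RepSpace.lin_comp, LinearMap.comp_apply, lin_linComb_single, skewMul_single,
      _root_.map_smul, h, smul_smul, List.ofFn_succ, ← Multiset.cons_coe, Multiset.cons_add,
      Multiset.add_cons]
    rfl

include hx in
/-- The monomials of degree `d` in classes mapping to `tau` times the multiplications by the
variables are linearly independent, because the functor takes them to `tau ^ d` times the monomials
in the skew polynomial ring. -/
lemma exists_linearIndependent_extWord [Nontrivial T] (d : ℕ) :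
    ∃ w : Sym ι d → Fin d → ι, LinearIndependent k fun s => extWord x d (w s) := by
  have hw (s : Sym ι d) : ∃ w : Fin d → ι, Multiset.ofList (List.ofFn w) = s.1 := by
    obtain ⟨s, rfl⟩ := s
    induction s using Quotient.inductionOn with
    | h l => exact ⟨l.get, congrArg _ (List.ofFn_get l)⟩
  choose w hw using hw
  refine ⟨w, ?_⟩
  obtain ⟨v, hv⟩ := exists_ne (0 : T)
  let F := functor k hc hsq
  let Ψ := SqZero.tauPowₗ (twist (k := k) y T) (twist_mul_twist T hc hsq) (twist_eq_zero hT) d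
  refine LinearIndependent.of_comp (F.mapExtLinearMap k T T d) ?_
  have e : (F.mapExtLinearMap k T T d) ∘ (fun s => extWord x d (w s)) =
      Ψ ∘ fun s => skewWord hc hsq hT d (w s) :=
    funext fun s => map_extWord hc hsq hT x hx d (w s)
  rw [e]
  refine LinearIndependent.map' ?_ Ψ (LinearMap.ker_eq_bot.2
    (SqZero.tauPowₗ_injective _ (twist_mul_twist T hc hsq) (twist_eq_zero hT) d))
  let ev : (obj k hc hsq T ⟶ obj k hc hsq T) →ₗ[k] (Multiset ι →₀ T) :=
    { toFun := fun g => RepSpace.lin g (Finsupp.single 0 v)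
      map_add' := fun g h => rfl
      map_smul' := fun r g => by rw [RepSpace.lin_smul]; rfl }
  refine LinearIndependent.of_comp ev ?_
  choose r hr hrv using fun s => skewWord_single (k := k) hc hsq hT d (w s) 0 v
  have e : ev ∘ (fun s => skewWord hc hsq hT d (w s)) = fun s =>
      (fun s => Units.mk0 (r s) (hr s)) s • Finsupp.single s.1 v := by
    funext s
    refine (hrv s).trans ?_
    rw [add_zero, hw]; rfl
  rw [e]
  refine LinearIndependent.units_smul (v := fun s : Sym ι d => Finsupp.single s.1 v) ?_ _
  exact (Finsupp.linearIndependent_single_of_ne_zero (v := fun _ : Multiset ι => v)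
    fun _ => hv).comp _ Subtype.val_injective

end

end KoszulTwist

/-! ### Modules over the Fomin-Kirillov algebra -/

namespace FominKirillov

open Abelian
open scoped ModuleCat

variable {k : Type u} [Field k] {n : ℕ}

variable (k) in
/-- The generator of the Fomin-Kirillov algebra with label `p`. -/
noncomputable def gen (p : Gen n) : FominKirillov k n :=
  RingQuot.mkAlgHom k (Rel k n) (FreeAlgebra.ι k p)

lemma gen_mul_self (p : Gen n) : gen k p * gen k p = 0 := by
  rw [gen, ← map_mul, ← map_zero (RingQuot.mkAlgHom k (Rel k n))]
  exact RingQuot.mkAlgHom_rel k (Rel.sq p.1.1 p.1.2 p.2)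

lemma gen_commute (p q : Gen n) (h : Disjoint ({p.1.1, p.1.2} : Set (Fin n)) {q.1.1, q.1.2}) :
    Commute (gen k p) (gen k q) := by
  rw [commute_iff_eq, ← sub_eq_zero, gen, gen, ← map_mul, ← map_mul, ← map_sub,
    ← map_zero (RingQuot.mkAlgHom k (Rel k n))]
  exact RingQuot.mkAlgHom_rel k (Rel.comm p.1.1 p.1.2 q.1.1 q.1.2 p.2 q.2 h)

@[elab_as_elim]
lemma gen_induction {P : FominKirillov k n → Prop} (hk : ∀ r, P (algebraMap k _ r))
    (hg : ∀ p, P (gen k p)) (hmul : ∀ a b, P a → P b → P (a * b))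
    (hadd : ∀ a b, P a → P b → P (a + b)) (a : FominKirillov k n) : P a := by
  obtain ⟨a, rfl⟩ := RingQuot.mkAlgHom_surjective k (Rel k n) a
  induction a using FreeAlgebra.induction with
  | grade0 r => rw [AlgHom.commutes]; exact hk r
  | grade1 p => exact hg p
  | mul a b ha hb => rw [map_mul]; exact hmul _ _ ha hb
  | add a b ha hb => rw [map_add]; exact hadd _ _ ha hb

/-- A linear map commuting with the generators, as a morphism of modules. -/
noncomputable def homOfGen {M N : ModuleCat.{u} (FominKirillov k n)} (f : M →ₗ[k] N)
    (hf : ∀ (p : Gen n) v, f (gen k p • v) = gen k p • f v) : M ⟶ N :=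
  ModuleCat.ofHom
    { toFun := f
      map_add' := f.map_add
      map_smul' := fun a => by
        induction a using gen_induction with
        | hk r => intro v; simp only [algebraMap_smul, map_smul, RingHom.id_apply]
        | hg p => exact hf p
        | hmul a b ha hb => intro v; simp only [mul_smul, RingHom.id_apply] at *; rw [ha, hb]
        | hadd a b ha hb =>
          intro v; simp only [add_smul, map_add, RingHom.id_apply] at *; rw [ha, hb] }

@[simp] lemma homOfGen_apply {M N : ModuleCat.{u} (FominKirillov k n)} (f : M →ₗ[k] N)
    (hf : ∀ (p : Gen n) v, f (gen k p • v) = gen k p • f v) (v : M) :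
    (homOfGen f hf).hom v = f v := rfl

/-- A bilinear form on the span of the generators which vanishes on the defining relations. These
forms are the relations of the quadratic dual algebra. -/
structure KillsRelations (φ : Gen n → Gen n → k) : Prop where
  sq (p : Gen n) : φ p p = 0
  triangle (i j l : Fin n) (hij : i < j) (hjl : j < l) :
    φ ⟨(i, j), hij⟩ ⟨(j, l), hjl⟩ - φ ⟨(j, l), hjl⟩ ⟨(i, l), hij.trans hjl⟩
      - φ ⟨(i, l), hij.trans hjl⟩ ⟨(i, j), hij⟩ = 0
  triangle' (i j l : Fin n) (hij : i < j) (hjl : j < l) :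
    φ ⟨(j, l), hjl⟩ ⟨(i, j), hij⟩ - φ ⟨(i, l), hij.trans hjl⟩ ⟨(j, l), hjl⟩
      - φ ⟨(i, j), hij⟩ ⟨(i, l), hij.trans hjl⟩ = 0
  comm (p q : Gen n) (h : Disjoint ({p.1.1, p.1.2} : Set (Fin n)) {q.1.1, q.1.2}) :
    φ p q - φ q p = 0

lemma KillsRelations.zero : KillsRelations (0 : Gen n → Gen n → k) := by
  constructor <;> simp

section

variable {V : Type u} [AddCommGroup V] [Module k V]

/-- Operators whose products are the values of a form vanishing on the relations, times a fixed
operator, define a representation. -/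
noncomputable def repOf {φ : Gen n → Gen n → k} (hφ : KillsRelations φ) (X : Gen n → Module.End k V)
    (Z : Module.End k V) (hX : ∀ p q, X p * X q = φ p q • Z) :
    FominKirillov k n →ₐ[k] Module.End k V :=
  RingQuot.liftAlgHom k ⟨FreeAlgebra.lift k X, by
    intro a b h
    cases h with
    | sq i j hij => simp [hX, hφ.sq]
    | triangle i j l hij hjl => simp [hX, ← sub_smul, hφ.triangle i j l hij hjl]
    | triangle' i j l hij hjl => simp [hX, ← sub_smul, hφ.triangle' i j l hij hjl]
    | comm i j l m hij hlm h =>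
      simp [hX, ← sub_smul, hφ.comm ⟨(i, j), hij⟩ ⟨(l, m), hlm⟩ h]⟩

@[simp] lemma repOf_gen {φ : Gen n → Gen n → k} (hφ : KillsRelations φ) (X : Gen n → Module.End k V)
    (Z : Module.End k V) (hX : ∀ p q, X p * X q = φ p q • Z) (p : Gen n) :
    repOf hφ X Z hX (gen k p) = X p := by
  simp [repOf, gen]

end

lemma gen_smul_trivialModule (p : Gen n) (v : trivialModule k n) : gen k p • v = 0 := by
  change augmentation k n (gen k p) * (show k from v) = 0
  have : augmentation k n (gen k p) = 0 := by simp [augmentation, gen]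
  rw [this, zero_mul]

instance : Nontrivial (trivialModule k n) := inferInstanceAs (Nontrivial k)

/-! ### Extensions of modules with trivial action -/

section Extension

variable {U W : ModuleCat.{u} (FominKirillov k n)}

lemma extRep_mul (θ : Gen n → U →ₗ[k] W) (p q : Gen n) :
    ((LinearMap.inr k U W ∘ₗ θ p ∘ₗ LinearMap.fst k U W : Module.End k (U × W)) *
      (LinearMap.inr k U W ∘ₗ θ q ∘ₗ LinearMap.fst k U W : Module.End k (U × W))) =
      (0 : Gen n → Gen n → k) p q • (0 : Module.End k (U × W)) := by
  ext <;> simp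

/-- The representation on `U × W` in which the generator `p` acts by `(u, w) ↦ (0, θ p u)`. -/
noncomputable def extRep (θ : Gen n → U →ₗ[k] W) : FominKirillov k n →ₐ[k] Module.End k (U × W) :=
  repOf KillsRelations.zero (fun p => LinearMap.inr k U W ∘ₗ θ p ∘ₗ LinearMap.fst k U W) 0
    (extRep_mul θ)

lemma gen_smul_extRep (θ : Gen n → U →ₗ[k] W) (p : Gen n) (u : U) (w : W) :
    gen k p • RepSpace.mk (extRep θ) (u, w) = RepSpace.mk (extRep θ) (0, θ p u) := by
  rw [RepSpace.smul_mk, extRep, repOf_gen]; rfl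

variable (hU : ∀ (p : Gen n) (u : U), gen k p • u = 0) (hW : ∀ (p : Gen n) (w : W), gen k p • w = 0)

/-- The extension of `U` by `W` with matrix entries `θ`. -/
noncomputable abbrev extSeq (θ : Gen n → U →ₗ[k] W) :
    ShortComplex (ModuleCat.{u} (FominKirillov k n)) where
  X₁ := W
  X₂ := ModuleCat.of _ (RepSpace (extRep θ))
  X₃ := U
  f := homOfGen ((RepSpace.mk (extRep θ)).toLinearMap ∘ₗ LinearMap.inr k U W) fun p w => by
    simp [hW, gen_smul_extRep]
  g := homOfGen (LinearMap.fst k U W ∘ₗ (RepSpace.mk (extRep θ)).symm.toLinearMap) fun p v => by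
    obtain ⟨⟨u, w⟩, rfl⟩ := (RepSpace.mk (extRep θ)).surjective v
    simp [hU, gen_smul_extRep]
  zero := ModuleCat.hom_ext (LinearMap.ext fun _ => rfl)

lemma extSeq_shortExact (θ : Gen n → U →ₗ[k] W) : (extSeq hU hW θ).ShortExact where
  exact := by
    rw [ShortComplex.moduleCat_exact_iff]
    intro v h
    obtain ⟨⟨u, w⟩, rfl⟩ := (RepSpace.mk (extRep θ)).surjective v
    obtain rfl : u = 0 := h
    exact ⟨w, rfl⟩
  mono_f := (ModuleCat.mono_iff_injective _).2 (LinearMap.inr_injective (R := k) (M := U) (M₂ := W))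
  epi_g := (ModuleCat.epi_iff_surjective _).2 (LinearMap.fst_surjective (R := k) (M := U) (M₂ := W))

/-- The class of `extSeq`. -/
noncomputable def extClass (θ : Gen n → U →ₗ[k] W) : Ext U W 1 :=
  (extSeq_shortExact hU hW θ).extClass

lemma extClass_naturality {U' W' : ModuleCat.{u} (FominKirillov k n)}
    (hU' : ∀ (p : Gen n) (u : U'), gen k p • u = 0) (hW' : ∀ (p : Gen n) (w : W'), gen k p • w = 0)
    (θ : Gen n → U →ₗ[k] W) (θ' : Gen n → U' →ₗ[k] W') (a : U ⟶ U') (b : W ⟶ W')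
    (h : ∀ p u, b.hom (θ p u) = θ' p (a.hom u)) :
    (extClass hU hW θ).comp (Ext.mk₀ b) (add_zero 1) =
      (Ext.mk₀ a).comp (extClass hU' hW' θ') (zero_add 1) :=
  (extSeq_shortExact hU hW θ).extClass_naturality (extSeq_shortExact hU' hW' θ')
    { τ₁ := b
      τ₂ := homOfGen ((RepSpace.mk (extRep θ')).toLinearMap ∘ₗ
          (a.hom.restrictScalars k).prodMap (b.hom.restrictScalars k) ∘ₗ
          (RepSpace.mk (extRep θ)).symm.toLinearMap) fun p v => by
        obtain ⟨⟨u, w⟩, rfl⟩ := (RepSpace.mk (extRep θ)).surjective v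
        simp [gen_smul_extRep, h]
      τ₃ := a
      comm₁₂ := by
        refine ModuleCat.hom_ext (LinearMap.ext fun w => ?_)
        change RepSpace.mk (extRep θ') (0, b.hom w) = RepSpace.mk (extRep θ') (a.hom 0, b.hom w)
        rw [map_zero]
      comm₂₃ := ModuleCat.hom_ext (LinearMap.ext fun _ => rfl) }

section Product

variable {U W Y : ModuleCat.{u} (FominKirillov k n)} (hU : ∀ (p : Gen n) (u : U), gen k p • u = 0)
  (hW : ∀ (p : Gen n) (w : W), gen k p • w = 0) (hY : ∀ (p : Gen n) (y : Y), gen k p • y = 0)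
  (θ : Gen n → U →ₗ[k] W) (η : Gen n → W →ₗ[k] Y)

/-- The operator `(u, w, y) ↦ (0, θ p u, η p w)`. -/
noncomputable def stepOp (p : Gen n) : Module.End k (U × W × Y) :=
  LinearMap.inr k U (W × Y) ∘ₗ ((θ p).prodMap (η p)) ∘ₗ
    (LinearMap.id (R := k) (M := U)).prodMap (LinearMap.fst k W Y)

lemma stepOp_apply (p : Gen n) (v : U × W × Y) : stepOp θ η p v = (0, θ p v.1, η p v.2.1) := rfl

variable {θ η} {φ : Gen n → Gen n → k} (hφ : KillsRelations φ) (ζ : U →ₗ[k] Y)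
  (h : ∀ p q u, η p (θ q u) = φ p q • ζ u)

include h in
lemma stepOp_mul (p q : Gen n) : stepOp θ η p * stepOp θ η q =
    φ p q • (LinearMap.inr k U (W × Y) ∘ₗ LinearMap.inr k W Y ∘ₗ ζ ∘ₗ
      LinearMap.fst k U (W × Y)) := by
  refine LinearMap.ext fun v => ?_
  simp [stepOp_apply, h]

include hφ h in
/-- If the products of the matrix entries of two extensions are the values of a form vanishing on
the relations, there is a module with subquotients `U`, `W`, `Y` inducing both extensions, so the
product of their classes vanishes. -/
lemma extClass_comp_extClass :
    (extClass hU hW θ).comp (extClass hW hY η) (show 1 + 1 = 2 from rfl) = 0 := by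
  let ρ : FominKirillov k n →ₐ[k] Module.End k (U × W × Y) :=
    repOf hφ (stepOp θ η) _ (stepOp_mul ζ h)
  have hρ (p : Gen n) (v : U × W × Y) :
      gen k p • RepSpace.mk ρ v = RepSpace.mk ρ (0, θ p v.1, η p v.2.1) := by
    rw [RepSpace.smul_mk, repOf_gen]; rfl
  let S : ShortComplex (ModuleCat.{u} (FominKirillov k n)) :=
    { X₁ := ModuleCat.of _ (RepSpace (extRep η))
      X₂ := ModuleCat.of _ (RepSpace ρ)
      X₃ := U
      f := homOfGen ((RepSpace.mk ρ).toLinearMap ∘ₗ LinearMap.inr k U (W × Y) ∘ₗ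
          (RepSpace.mk (extRep η)).symm.toLinearMap) fun p v => by
        obtain ⟨⟨w, y⟩, rfl⟩ := (RepSpace.mk (extRep η)).surjective v
        simp [gen_smul_extRep, hρ]
      g := homOfGen (LinearMap.fst k U (W × Y) ∘ₗ (RepSpace.mk ρ).symm.toLinearMap) fun p v => by
        obtain ⟨⟨u, w, y⟩, rfl⟩ := (RepSpace.mk ρ).surjective v
        simp [hU, hρ]
      zero := ModuleCat.hom_ext (LinearMap.ext fun _ => rfl) }
  have hS : S.ShortExact :=
    { exact := by
        rw [ShortComplex.moduleCat_exact_iff]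
        intro v h
        obtain ⟨⟨u, w⟩, rfl⟩ := (RepSpace.mk ρ).surjective v
        obtain rfl : u = 0 := h
        exact ⟨RepSpace.mk (extRep η) w, rfl⟩
      mono_f := (ModuleCat.mono_iff_injective _).2
        (LinearMap.inr_injective (R := k) (M := U) (M₂ := W × Y))
      epi_g := (ModuleCat.epi_iff_surjective _).2
        (LinearMap.fst_surjective (R := k) (M := U) (M₂ := W × Y)) }
  have nat := hS.extClass_naturality (extSeq_shortExact hU hW θ)
    { τ₁ := (extSeq hW hY η).g
      τ₂ := homOfGen ((RepSpace.mk (extRep θ)).toLinearMap ∘ₗ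
          (LinearMap.id (R := k) (M := U)).prodMap (LinearMap.fst k W Y) ∘ₗ
          (RepSpace.mk ρ).symm.toLinearMap) fun p v => by
        obtain ⟨⟨u, w, y⟩, rfl⟩ := (RepSpace.mk ρ).surjective v
        simp [gen_smul_extRep, hρ]
      τ₃ := 𝟙 U
      comm₁₂ := ModuleCat.hom_ext (LinearMap.ext fun _ => rfl)
      comm₂₃ := ModuleCat.hom_ext (LinearMap.ext fun _ => rfl) }
  have e : extClass hU hW θ = hS.extClass.comp (Ext.mk₀ (extSeq hW hY η).g) (add_zero 1) :=
    (Ext.mk₀_id_comp _).symm.trans nat.symm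
  rw [e, Ext.comp_assoc _ _ _ (add_zero 1) (zero_add 1) (by omega), extClass,
    (extSeq_shortExact hW hY η).comp_extClass, Ext.comp_zero]

end Product

end Extension

/-! ### Classes of degree one and their relations -/

/-- The element of `Ext¹(k, k)` given by a linear functional `f` on the span of the generators. -/
noncomputable def genClass (f : Gen n → k) : Ext (trivialModule k n) (trivialModule k n) 1 :=
  extClass gen_smul_trivialModule gen_smul_trivialModule fun p => f p • LinearMap.id

lemma genClass_neg (f : Gen n → k) : genClass (-f) = -genClass f := by
  have := extClass_naturality gen_smul_trivialModule gen_smul_trivialModule gen_smul_trivialModule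
    gen_smul_trivialModule (fun p => f p • LinearMap.id) (fun p => (-f) p • LinearMap.id)
    (𝟙 (trivialModule k n)) (-𝟙 (trivialModule k n)) (by simp)
  rw [Ext.mk₀_id_comp, Ext.mk₀_neg, Ext.comp_neg, Ext.comp_mk₀_id] at this
  exact this.symm

/-- Relations of the quadratic dual algebra hold between the classes of degree one. The sum is the
product of the extension of `k` by `k × k` with entries `f₁, f₂` and the extension of `k × k` by `k`
with entries `g₁, g₂`. In the Yoneda product, written in diagrammatic order, the module is acted on
by the matrix entries of the first factor before those of the second, so `f₁ q` comes on the right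
in the form. -/
lemma genClass_comp_add (f₁ f₂ g₁ g₂ : Gen n → k)
    (h : KillsRelations fun p q => g₁ p * f₁ q + g₂ p * f₂ q) :
    (genClass f₁).comp (genClass g₁) (show 1 + 1 = 2 from rfl) +
      (genClass f₂).comp (genClass g₂) (show 1 + 1 = 2 from rfl) = 0 := by
  let T := trivialModule k n
  let ρ : FominKirillov k n →ₐ[k] Module.End k (T × T) :=
    repOf KillsRelations.zero (fun _ => 0) 0 (by simp)
  let m := RepSpace.mk ρ
  have hρ (p : Gen n) (v : RepSpace ρ) : gen k p • v = 0 := by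
    obtain ⟨v, rfl⟩ := m.surjective v
    rw [RepSpace.smul_mk, repOf_gen]; simp
  let T₂ := ModuleCat.of (FominKirillov k n) (RepSpace ρ)
  have hT := gen_smul_trivialModule (k := k) (n := n)
  let θ (p : Gen n) : T →ₗ[k] T₂ := m.toLinearMap ∘ₗ
    (f₁ p • LinearMap.inl k T T + f₂ p • LinearMap.inr k T T)
  let η (p : Gen n) : T₂ →ₗ[k] T :=
    (g₁ p • LinearMap.fst k T T + g₂ p • LinearMap.snd k T T) ∘ₗ m.symm.toLinearMap
  let i₁ : T ⟶ T₂ := homOfGen (m.toLinearMap ∘ₗ LinearMap.inl k T T) fun p v => by simp [hT, T, hρ]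
  let i₂ : T ⟶ T₂ := homOfGen (m.toLinearMap ∘ₗ LinearMap.inr k T T) fun p v => by simp [hT, T, hρ]
  let p₁ : T₂ ⟶ T := homOfGen (LinearMap.fst k T T ∘ₗ m.symm.toLinearMap) fun p v => by
    simp [hT, T, T₂, hρ]
  let p₂ : T₂ ⟶ T := homOfGen (LinearMap.snd k T T ∘ₗ m.symm.toLinearMap) fun p v => by
    simp [hT, T, T₂, hρ]
  have hid : 𝟙 T₂ = p₁ ≫ i₁ + p₂ ≫ i₂ := by
    refine ModuleCat.hom_ext (LinearMap.ext fun v => ?_)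
    obtain ⟨⟨a, b⟩, rfl⟩ := m.surjective v
    change m (a, b) = m (a, 0) + m (0, b)
    rw [← map_add]; simp
  have hp₁ : (extClass hT hρ θ).comp (Ext.mk₀ p₁) (add_zero 1) = genClass f₁ := by
    refine (extClass_naturality hT hρ hT hT _ (fun p => f₁ p • LinearMap.id) (𝟙 T) p₁ ?_).trans
      (Ext.mk₀_id_comp _)
    intro p u
    change f₁ p • u + f₂ p • (0 : T) = f₁ p • u
    simp
  have hp₂ : (extClass hT hρ θ).comp (Ext.mk₀ p₂) (add_zero 1) = genClass f₂ := by
    refine (extClass_naturality hT hρ hT hT _ (fun p => f₂ p • LinearMap.id) (𝟙 T) p₂ ?_).trans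
      (Ext.mk₀_id_comp _)
    intro p u
    change f₁ p • (0 : T) + f₂ p • u = f₂ p • u
    simp
  have hi₁ : (Ext.mk₀ i₁).comp (extClass hρ hT η) (zero_add 1) = genClass g₁ := by
    refine (extClass_naturality hT hT hρ hT (fun p => g₁ p • LinearMap.id) _ i₁ (𝟙 T) ?_).symm.trans
      (Ext.comp_mk₀_id _)
    intro p u
    change g₁ p • u = g₁ p • u + g₂ p • (0 : T)
    simp
  have hi₂ : (Ext.mk₀ i₂).comp (extClass hρ hT η) (zero_add 1) = genClass g₂ := by
    refine (extClass_naturality hT hT hρ hT (fun p => g₂ p • LinearMap.id) _ i₂ (𝟙 T) ?_).symm.trans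
      (Ext.comp_mk₀_id _)
    intro p u
    change g₂ p • u = g₁ p • (0 : T) + g₂ p • u
    simp
  have h0 := extClass_comp_extClass hT hρ hT (θ := θ) (η := η) h LinearMap.id (by
    intro p q u
    change g₁ p • (f₁ q • u + f₂ q • (0 : T)) + g₂ p • (f₁ q • (0 : T) + f₂ q • u) =
      (g₁ p * f₁ q + g₂ p * f₂ q) • u
    simp [mul_smul, add_smul])
  rw [← Ext.mk₀_id_comp (extClass hρ hT η), hid, Ext.mk₀_add, Ext.add_comp, Ext.comp_add,
    ← Ext.mk₀_comp_mk₀, ← Ext.mk₀_comp_mk₀] at h0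
  rw [← hp₁, ← hp₂, ← hi₁, ← hi₂, ← h0]
  congr 1
  · rw [Ext.comp_assoc _ _ _ (add_zero 1) (zero_add 1) (by omega),
      Ext.comp_assoc _ _ _ (zero_add 0) (zero_add 1) (by omega)]
  · rw [Ext.comp_assoc _ _ _ (add_zero 1) (zero_add 1) (by omega),
      Ext.comp_assoc _ _ _ (zero_add 0) (zero_add 1) (by omega)]

variable (k) in
/-- The functional dual to the generator `p`. -/
noncomputable def dual (p : Gen n) : Gen n → k := Pi.single p 1

/-- The case of `genClass_comp_add` in which the form has at most two nonzero values: `1` at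
`(P, Q)` and `s` at `(R, S)`. -/
lemma genClass_dual_relation (P Q R S : Gen n) (s : k)
    (h : KillsRelations fun p q : Gen n =>
      (if p = P ∧ q = Q then 1 else 0) + (if p = R ∧ q = S then s else 0)) :
    (genClass (dual k Q)).comp (genClass (dual k P)) (show 1 + 1 = 2 from rfl) +
      (genClass (dual k S)).comp (genClass (s • dual k R)) (show 1 + 1 = 2 from rfl) = 0 := by
  refine genClass_comp_add _ _ _ _ ?_
  convert h using 3 with p q
  simp only [dual, Pi.single_apply, Pi.smul_apply, smul_eq_mul]
  split_ifs <;> simp_all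

section Triangle

variable {a b c : Fin n} (hab : a < b) (hbc : b < c)

lemma genClass_triangle₁ :
    (genClass (dual k ⟨(a, b), hab⟩)).comp (genClass (dual k ⟨(b, c), hbc⟩))
        (show 1 + 1 = 2 from rfl) =
      -(genClass (dual k ⟨(b, c), hbc⟩)).comp (genClass (dual k ⟨(a, c), hab.trans hbc⟩))
        (show 1 + 1 = 2 from rfl) := by
  have h := genClass_dual_relation (k := k) ⟨(b, c), hbc⟩ ⟨(a, b), hab⟩ ⟨(a, c), hab.trans hbc⟩
    ⟨(b, c), hbc⟩ 1
    { sq := fun p => by grind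
      triangle := fun i j l hij hjl => by grind
      triangle' := fun i j l hij hjl => by grind
      comm := fun p q h => by
        simp only [Set.disjoint_insert_left, Set.disjoint_singleton_left, Set.mem_insert_iff,
          Set.mem_singleton_iff] at h
        grind }
  rw [one_smul] at h
  exact eq_neg_of_add_eq_zero_left h

lemma genClass_triangle₂ :
    (genClass (dual k ⟨(a, b), hab⟩)).comp (genClass (dual k ⟨(b, c), hbc⟩))
        (show 1 + 1 = 2 from rfl) =
      -(genClass (dual k ⟨(a, c), hab.trans hbc⟩)).comp (genClass (dual k ⟨(a, b), hab⟩))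
        (show 1 + 1 = 2 from rfl) := by
  have h := genClass_dual_relation (k := k) ⟨(b, c), hbc⟩ ⟨(a, b), hab⟩ ⟨(a, b), hab⟩
    ⟨(a, c), hab.trans hbc⟩ 1
    { sq := fun p => by grind
      triangle := fun i j l hij hjl => by grind
      triangle' := fun i j l hij hjl => by grind
      comm := fun p q h => by
        simp only [Set.disjoint_insert_left, Set.disjoint_singleton_left, Set.mem_insert_iff,
          Set.mem_singleton_iff] at h
        grind }
  rw [one_smul] at h
  exact eq_neg_of_add_eq_zero_left h

lemma genClass_triangle₃ :
    (genClass (dual k ⟨(a, b), hab⟩)).comp (genClass (dual k ⟨(a, c), hab.trans hbc⟩))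
        (show 1 + 1 = 2 from rfl) =
      (genClass (dual k ⟨(a, c), hab.trans hbc⟩)).comp (genClass (dual k ⟨(b, c), hbc⟩))
        (show 1 + 1 = 2 from rfl) := by
  have h := genClass_dual_relation (k := k) ⟨(a, c), hab.trans hbc⟩ ⟨(a, b), hab⟩ ⟨(b, c), hbc⟩
    ⟨(a, c), hab.trans hbc⟩ (-1)
    { sq := fun p => by grind
      triangle := fun i j l hij hjl => by grind
      triangle' := fun i j l hij hjl => by grind
      comm := fun p q h => by
        simp only [Set.disjoint_insert_left, Set.disjoint_singleton_left, Set.mem_insert_iff,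
          Set.mem_singleton_iff] at h
        grind }
  rw [neg_one_smul, genClass_neg, Ext.comp_neg] at h
  exact add_neg_eq_zero.1 h

end Triangle

section Matching

variable {ι : Type} [LinearOrder ι] [Fintype ι] {e : ι → Gen n}
  (hc : ∀ i j, Commute (gen k (e i)) (gen k (e j)))
  (hsq : ∀ i, gen k (e i) * gen k (e i) = 0)

/-- Under the functor given by commuting generators `e i`, the class of the functional `f` only
remembers the values `f (e i)`. -/
lemma map_genClass (f : Gen n → k) :
    (genClass f).mapExactFunctor (KoszulTwist.functor k hc hsq) =
      SqZero.tauPow _ (KoszulTwist.twist_mul_twist _ hc hsq)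
        (KoszulTwist.twist_eq_zero fun i => gen_smul_trivialModule (e i)) 1
        (KoszulTwist.linComb k hc hsq (fun i => gen_smul_trivialModule (e i)) (f ∘ e)) :=
  KoszulTwist.map_extClass hc hsq _ _ _ _
    (extSeq_shortExact gen_smul_trivialModule gen_smul_trivialModule fun p => f p • LinearMap.id)
    ((RepSpace.mk (extRep _)).toLinearMap ∘ₗ LinearMap.inl k _ _) (fun _ => rfl) (f ∘ e)
    fun _ _ => gen_smul_extRep _ _ _ _

lemma map_genClass_dual (he : Function.Injective e) (i : ι) :
    (genClass (dual k (e i))).mapExactFunctor (KoszulTwist.functor k hc hsq) =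
      SqZero.tauPow _ (KoszulTwist.twist_mul_twist _ hc hsq)
        (KoszulTwist.twist_eq_zero fun i => gen_smul_trivialModule (e i)) 1
        (KoszulTwist.linComb k hc hsq (fun i => gen_smul_trivialModule (e i)) (Pi.single i 1)) := by
  rw [map_genClass]
  congr 2
  ext j
  simp [dual, Pi.single_apply, he.eq_iff]

end Matching

end FominKirillov

/-! ### Growth -/

/-- The bound holds since `m ^ N / N! ≤ (N + m).choose N`. -/
lemma le_growthExponent (N : ℕ) (d : ℕ → ℕ∞) (hd : ∀ m, (((N + m).choose N : ℕ) : ℕ∞) ≤ d m) :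
    (((N : ℕ) : ℝ) : EReal) ≤ growthExponent d := by
  have hlim : Filter.Tendsto (fun m : ℕ => (((N * Real.log m - Real.log N.factorial) /
      Real.log m : ℝ) : EReal)) Filter.atTop (nhds ((N : ℝ) : EReal)) := by
    refine (continuous_coe_real_ereal.tendsto _).comp ?_
    have hlog : Filter.Tendsto (fun m : ℕ => Real.log m) Filter.atTop Filter.atTop :=
      Real.tendsto_log_atTop.comp tendsto_natCast_atTop_atTop
    have h1 := (tendsto_const_nhds (x := (N : ℝ))).sub
      ((tendsto_const_nhds (x := Real.log N.factorial)).div_atTop hlog)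
    rw [sub_zero] at h1
    refine h1.congr' ?_
    filter_upwards [hlog.eventually_gt_atTop 0] with m hm
    field_simp
  rw [← hlim.limsup_eq, growthExponent]
  refine Filter.limsup_le_limsup ?_
  filter_upwards [Filter.eventually_ge_atTop 1] with m hm
  rw [EReal.coe_div]
  have hm' : (1 : ℝ) ≤ m := by exact_mod_cast hm
  refine EReal.div_le_div_right_of_nonneg (by exact_mod_cast Real.log_nonneg hm') ?_
  have hpos : (0 : ℝ) < (m : ℝ) ^ N / N.factorial := by positivity
  have hreal : (N * Real.log m - Real.log N.factorial : ℝ) =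
      Real.log ((m : ℝ) ^ N / N.factorial) := by
    rw [Real.log_div (by positivity) (by positivity), Real.log_pow]
  rw [hreal, ← ENNReal.log_ofReal_of_pos hpos]
  refine ENNReal.log_monotone (le_trans ?_ (ENat.toENNReal_mono (hd m)))
  rw [ENat.toENNReal_coe, ← ENNReal.ofReal_natCast]
  refine ENNReal.ofReal_le_ofReal (le_trans ?_ (Nat.pow_le_choose N (N + m)))
  gcongr
  omega

lemma card_le_toENat_rank {k V ι : Type*} [Field k] [AddCommGroup V] [Module k V] [Fintype ι]
    {v : ι → V} (hv : LinearIndependent k v) :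
    (Fintype.card ι : ℕ∞) ≤ Cardinal.toENat (Module.rank k V) := by
  rw [Cardinal.natCast_le_toENat]
  have h := hv.cardinal_lift_le_rank
  rw [Cardinal.mk_fintype, Cardinal.lift_natCast] at h
  rwa [Cardinal.nat_le_lift_iff] at h

/-- `Sym (Fin N) d` indexes the monomials of degree `d` in `N` variables. -/
lemma le_gradedGKDim {k : Type*} [Field k] {A : ℕ → Type*} [∀ i, AddCommGroup (A i)]
    [∀ i, Module k (A i)] (N : ℕ) {v : ∀ d, Sym (Fin N) d → A d}
    (hv : ∀ d, LinearIndependent k (v d)) : (((N : ℕ) : ℝ) : EReal) ≤ gradedGKDim k A := by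
  refine le_growthExponent N _ fun m => ?_
  rw [add_comm N m, ← Nat.sum_range_multichoose, Nat.cast_sum]
  refine Finset.sum_le_sum fun d _ => ?_
  have h := card_le_toENat_rank (hv d)
  rwa [Sym.card_sym_eq_multichoose, Fintype.card_fin] at h

lemma card_le_toENat_rank_of_mem {k V ι : Type*} [Field k] [AddCommGroup V] [Module k V]
    [Fintype ι] {v : ι → V} (hv : LinearIndependent k v) (W : Submodule k V) (h : ∀ i, v i ∈ W) :
    (Fintype.card ι : ℕ∞) ≤ Cardinal.toENat (Module.rank k W) :=
  card_le_toENat_rank (v := fun i => (⟨v i, h i⟩ : W)) (LinearIndependent.of_comp W.subtype hv)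

/-- The ungraded bound is attained on the span of the `x i`, whose `d`-th power contains the
`v d s`. -/
lemma le_gkDim {k : Type*} [Field k] {B : ℕ → Type*} [∀ i, AddCommGroup (B i)]
    [∀ i, Module k (B i)] [DirectSum.GRing B] [DirectSum.GAlgebra k B] (N : ℕ) (x : Fin N → B 1)
    {v : ∀ d, Sym (Fin N) d → B d} (hv : ∀ d, LinearIndependent k (v d))
    (hmem : ∀ d s, DirectSum.of B d (v d s) ∈
      (Submodule.span k (Set.range fun i => DirectSum.of B 1 (x i)) ^ d :
        Submodule k (⨁ i, B i))) :
    (((N : ℕ) : ℝ) : EReal) ≤ gkDim k (⨁ i, B i) := by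
  let V : Submodule k (⨁ i, B i) := Submodule.span k (Set.range fun i => DirectSum.of B 1 (x i))
  have hV : FiniteDimensional k V := FiniteDimensional.span_of_finite k (Set.finite_range _)
  have hli : LinearIndependent k fun p : Σ d, Sym (Fin N) d =>
      (DirectSum.of B p.1 (v p.1 p.2) : ⨁ i, B i) :=
    DFinsupp.linearIndependent_single _ hv
  unfold gkDim
  refine le_iSup_of_le ⟨V, hV⟩ (le_growthExponent N _ fun m => ?_)
  have hli' := hli.comp (fun p : Σ d : Fin (m + 1), Sym (Fin N) d => ⟨(p.1 : ℕ), p.2⟩)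
    (Function.Injective.sigma_map Fin.val_injective fun _ => Function.injective_id)
  have h := card_le_toENat_rank_of_mem hli' (⨆ i ∈ Finset.range (m + 1), V ^ i) fun p =>
    Submodule.mem_iSup_of_mem (p.1 : ℕ) (Submodule.mem_iSup_of_mem
      (Finset.mem_range.2 p.1.2) (hmem _ _))
  rw [Fintype.card_sigma] at h
  simp only [Sym.card_sym_eq_multichoose, Fintype.card_fin] at h
  rwa [Fin.sum_univ_eq_sum_range (fun d => N.multichoose d), Nat.sum_range_multichoose,
    add_comm m N] at h

namespace KoszulTwist

open Abelian

lemma of_extWord_mem {k : Type u} [Field k] {A : Type u} [Ring A] [Algebra k A]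
    {T : ModuleCat.{u} A} {ι : Type} (x : ι → Ext T T 1) (d : ℕ) (w : Fin d → ι) :
    DirectSum.of (fun i => Ext T T i) d (extWord x d w) ∈
      (Submodule.span k (Set.range fun i => DirectSum.of (fun i => Ext T T i) 1 (x i)) ^ d :
        Submodule k (⨁ i, Ext T T i)) := by
  induction d with
  | zero => rw [pow_zero]; exact Submodule.one_le.1 le_rfl
  | succ d ih =>
    rw [pow_succ']
    have e : DirectSum.of (fun i => Ext T T i) (d + 1) (extWord x (d + 1) w) =
        DirectSum.of (fun i => Ext T T i) 1 (x (w 0)) *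
          DirectSum.of (fun i => Ext T T i) d (extWord x d (Fin.tail w)) := by
      rw [DirectSum.of_mul_of]
      exact DirectSum.of_eq_of_gradedMonoid_eq
        (ExtAlg.mk_comp_eq (x (w 0)) (extWord x d (Fin.tail w)) (add_comm 1 d) rfl)
    rw [e]
    exact Submodule.mul_mem_mul (Submodule.subset_span ⟨w 0, rfl⟩) (ih _)

end KoszulTwist

/-! ### The matching and the triangle -/

namespace FominKirillov

open Abelian
open scoped ModuleCat

variable {k : Type u} [Field k] {n : ℕ}

/-- The generators `x_{0,1}, x_{2,3}, …` with pairwise disjoint labels. -/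
def matching (n : ℕ) (i : Fin (n / 2)) : Gen n :=
  ⟨(⟨2 * i, by omega⟩, ⟨2 * i + 1, by omega⟩), by simp [Fin.lt_def]⟩

lemma matching_injective : Function.Injective (matching n) := by
  intro i j h
  have : 2 * (i : ℕ) = 2 * j := congrArg (fun p : Gen n => (p.1.1 : ℕ)) h
  omega

lemma matching_commute (i j : Fin (n / 2)) :
    Commute (gen k (matching n i)) (gen k (matching n j)) := by
  by_cases h : i = j
  · rw [h]
  · refine gen_commute _ _ ?_
    have h' : (i : ℕ) ≠ j := fun e => h (Fin.ext e)
    simp only [matching, Set.disjoint_insert_left, Set.disjoint_singleton_left,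
      Set.mem_insert_iff, Set.mem_singleton_iff, Fin.mk.injEq]
    omega

lemma exists_linearIndependent (d : ℕ) : ∃ w : Sym (Fin (n / 2)) d → Fin d → Fin (n / 2),
    LinearIndependent k fun s =>
      KoszulTwist.extWord (fun i => genClass (dual k (matching n i))) d (w s) :=
  KoszulTwist.exists_linearIndependent_extWord matching_commute (fun _ => gen_mul_self _) _ _
    (map_genClass_dual _ _ matching_injective) d

/-- The functor of the single element `x_p` takes the left side to `tau ^ 2` times the square of
the multiplication by the variable, and the right side to zero. -/
lemma genClass_dual_comp_self_ne (p q : Gen n) (h : p ≠ q) :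
    (genClass (dual k p)).comp (genClass (dual k p)) (show 1 + 1 = 2 from rfl) ≠
      (genClass (dual k q)).comp (genClass (dual k q)) (show 1 + 1 = 2 from rfl) := by
  intro he
  let e : Fin 1 → Gen n := fun _ => p
  have hc (i j : Fin 1) : Commute (gen k (e i)) (gen k (e j)) := Commute.refl _
  have hsq (i : Fin 1) : gen k (e i) * gen k (e i) = 0 := gen_mul_self _
  have hT (i : Fin 1) (v : trivialModule k n) := gen_smul_trivialModule (e i) v
  have h1 := KoszulTwist.map_comp_eq_tauPow hc hsq hT (map_genClass hc hsq (dual k p))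
    (map_genClass hc hsq (dual k p))
  have h2 := KoszulTwist.map_comp_eq_tauPow hc hsq hT (map_genClass hc hsq (dual k q))
    (map_genClass hc hsq (dual k q))
  have hq : dual k q ∘ e = 0 := by ext; simp [dual, e, h]
  have hp : dual k p ∘ e = Pi.single 0 1 := by ext i; simp [dual, e, Fin.fin_one_eq_zero]
  have h3 := SqZero.tauPowₗ_injective _ (KoszulTwist.twist_mul_twist _ hc hsq)
    (KoszulTwist.twist_eq_zero hT) 2 (h1.symm.trans ((congrArg _ he).trans h2))
  have h4 := congrArg RepSpace.lin h3
  rw [hq, hp, KoszulTwist.linComb_zero, RepSpace.lin_comp, RepSpace.lin_comp,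
    KoszulTwist.lin_linComb_single, RepSpace.lin_zero] at h4
  obtain ⟨v, hv⟩ := exists_ne (0 : trivialModule k n)
  have h5 := LinearMap.congr_fun h4 (Finsupp.single 0 v)
  simp [hv] at h5

lemma genClass_dual_ne_zero (p : Gen n) : genClass (dual k p) ≠ 0 := by
  intro h
  let e : Fin 1 → Gen n := fun _ => p
  obtain ⟨w, hw⟩ := KoszulTwist.exists_linearIndependent_extWord (y := fun i => gen k (e i))
    (fun _ _ => Commute.refl _) (fun _ => gen_mul_self _) (fun i => gen_smul_trivialModule (e i))
    (fun i => genClass (dual k (e i)))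
    (map_genClass_dual _ _ (Function.injective_of_subsingleton e)) 1
  refine hw.ne_zero (Sym.replicate 1 0) ?_
  rw [KoszulTwist.extWord, h, Ext.zero_comp]

lemma le_gradedGKDim_ext : (((n / 2 : ℕ) : ℝ) : EReal) ≤
    gradedGKDim k fun i => Ext (trivialModule k n) (trivialModule k n) i := by
  choose w hw using exists_linearIndependent (k := k) (n := n)
  exact le_gradedGKDim _ hw

lemma le_gkDim_extAlgebra : (((n / 2 : ℕ) : ℝ) : EReal) ≤
    gkDim k (ExtAlgebra (trivialModule k n)) := by
  choose w hw using exists_linearIndependent (k := k) (n := n)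
  exact le_gkDim _ (fun i => genClass (dual k (matching n i))) hw fun d s =>
    KoszulTwist.of_extWord_mem _ _ _

/-- Let `α`, `β`, `γ` be the classes dual to `x_{a,b}`, `x_{b,c}`, `x_{a,c}`. The relations
`α β = -β γ = -γ α` and `α γ = γ β` give `α² β = -α β γ = γ α γ = γ² β`. -/
lemma exists_mul_eq_zero {a b c : Fin n} (hab : a < b) (hbc : b < c) :
    ∃ x y : ExtAlgebra (trivialModule k n), x ≠ 0 ∧ y ≠ 0 ∧ x * y = 0 := by
  let o (d : ℕ) := DirectSum.of (fun i => Ext (trivialModule k n) (trivialModule k n) i) d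
  have ho (d : ℕ) : Function.Injective (o d) := DirectSum.of_injective d
  have hmul (x y : Ext (trivialModule k n) (trivialModule k n) 1) :
      o 1 x * o 1 y = o 2 (x.comp y (show 1 + 1 = 2 from rfl)) := DirectSum.of_mul_of x y
  let α := genClass (dual k ⟨(a, b), hab⟩)
  let β := genClass (dual k ⟨(b, c), hbc⟩)
  let γ := genClass (dual k ⟨(a, c), hab.trans hbc⟩)
  have h₁ : o 1 α * o 1 β = -(o 1 β * o 1 γ) := by
    rw [hmul, hmul, ← map_neg]; exact congrArg (o 2) (genClass_triangle₁ hab hbc)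
  have h₂ : o 1 α * o 1 β = -(o 1 γ * o 1 α) := by
    rw [hmul, hmul, ← map_neg]; exact congrArg (o 2) (genClass_triangle₂ hab hbc)
  have h₃ : o 1 α * o 1 γ = o 1 γ * o 1 β := by
    rw [hmul, hmul]; exact congrArg (o 2) (genClass_triangle₃ hab hbc)
  refine ⟨o 1 α * o 1 α - o 1 γ * o 1 γ, o 1 β, ?_, ?_, ?_⟩
  · rw [hmul, hmul, sub_ne_zero]
    refine (ho 2).ne (genClass_dual_comp_self_ne _ _ ?_)
    simp [hbc.ne]
  · exact fun h => genClass_dual_ne_zero _ (ho 1 (h.trans (map_zero (o 1)).symm))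
  · rw [sub_mul, sub_eq_zero]
    calc o 1 α * o 1 α * o 1 β = -(o 1 α * o 1 β * o 1 γ) := by
          rw [mul_assoc, h₁, mul_neg, ← mul_assoc, h₁]
      _ = o 1 γ * (o 1 α * o 1 γ) := by rw [h₂, neg_mul, neg_neg, mul_assoc]
      _ = o 1 γ * o 1 γ * o 1 β := by rw [h₃, mul_assoc]

end FominKirillov

theorem corollary0p5 (k : Type u) [Field k] [IsAlgClosed k] [CharZero k] (n : ℕ) :
    (2 ≤ n →
      (((n / 2 : ℕ) : ℝ) : EReal) ≤ gkDim k (ExtAlgebra (FominKirillov.trivialModule k n)) ∧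
      (((n / 2 : ℕ) : ℝ) : EReal) ≤ gradedGKDim k (fun i : ℕ =>
        Abelian.Ext (FominKirillov.trivialModule k n) (FominKirillov.trivialModule k n) i)) ∧
    (3 ≤ n → ∃ a b : ExtAlgebra (FominKirillov.trivialModule k n),
      a ≠ 0 ∧ b ≠ 0 ∧ a * b = 0) :=
  ⟨fun _ => ⟨FominKirillov.le_gkDim_extAlgebra, FominKirillov.le_gradedGKDim_ext⟩,
    fun hn => FominKirillov.exists_mul_eq_zero (a := ⟨0, by omega⟩) (b := ⟨1, by omega⟩)
      (c := ⟨2, by omega⟩) (by simp [Fin.lt_def]) (by simp [Fin.lt_def])⟩
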